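/- For every $\varepsilon>0$ there is an $N$ such that the following holds for all $n\ge N$. Let $M$ be a matroid of rank $n$, let $f=\lfloor(1-\varepsilon)n/2\rfloor$ (read as $0$ if this is negative), and let $B_{i,j}$ be a basis of $M$ for each $1\le i\le f$ and $1\le j\le n$. Then there exist representatives $b_{i,j}\in B_{i,j}$ (for all $1\le i\le f$, $1\le j\le n$) and a set $L\subseteq\{1,\dots,f\}$ with $|L|\ge(1/2-\varepsilon)n$ such that for each $i\in L$ the row $\{b_{i,1},\dots,b_{i,n}\}$ is a basis of $M$, and for each $1\le j\le n$ the elements $b_{i,j}$, $i\in L$, are pairwise distinct and form an independent set of $M$. -/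

import Mathlib

/-!
It turns out that every row can be completed, so `L` may be taken to be the set of all rows.
Tagging each element of `B i j` with its cell `(i, j)`, and pulling `M` back along the map that
forgets the tags, gives a matroid `N` on a finite type with a row and a column label. A choice of
representatives is then a set with one element per cell and with independent rows and columns.
Take a partial array `S` of this kind with the largest number of elements and suppose that the cell
`(i, c)` is vacant.

*Exchanges.* At least `n - f` elements `y` of the cell fit into column `c`, whose at most `f`
elements span few of them. By maximality row `i` spans each such `y`, so the elements `z` of row `i`
that can be replaced by one of them number at least `n - f`. After such a replacement the cell of
`z`, in column `c'`, can take an element `x` outside the span of the row, and since by maximality `x`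
depends on the rest of column `c'`, some other element `w` of that column, in row `i'`, is removed.
The result is again a maximum array, now with the cell `(i', c')` vacant.

*Cascades.* Repeat this. If every cell `(i, c)` with `c ∈ Q` can be vacated, by cascades that
change only the rows `P` and a few columns, then the next exchanges vacate almost
`|Q| (n - f)` different cells (`card_mul_le_card_canVacate`): for a column `c'`, the
elements `x` that serve for some `c ∈ Q'` are those not spanned by row `i` minus its elements in
the columns `Q'`, and there are `|Q'|` of these. As there are `f` rows and `n - f` exceeds `f` by a
constant factor, some row gets more cells than `Q` had by such a factor, and after
logarithmically many rounds more than `n`, which is absurd.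

*Revisited rows.* Cells in the rows `P` must be discarded, since the cascades have altered these
rows. Fix `Λ` of order `√n`. If in no maximum array the exchanges at one vacant cell can vacate
more than `Λ` cells of one row (`IsSpread`), then at most `|Q| |P| Λ` cells are lost in a round.
Otherwise some maximum array reaches more than `Λ` cells of one row in a single exchange; starting
there, always `|Q| ≥ Λ`, and the trivial bound `n |P| ≤ |Q| |P| Λ` for the loss suffices
(`exists_isReachable_of_isReachable`, `IsMaximum.not_isVacant`).
-/

namespace PartialArray

open Set

variable {β ι κ γ : Type*}

/-! ### Independent sets and closures -/

/-- If `R` is independent, an element spanned by `R` is already spanned by those members of `R`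
that cannot be deleted without losing it (they form its fundamental circuit). -/
theorem mem_closure_of_forall_mem_closure_diff {N : Matroid β} {R A : Set β} {y : β}
    (hR : N.Indep R) (hA : A ⊆ R) (hy : y ∈ N.closure R)
    (h : ∀ z ∈ R, z ∉ A → y ∈ N.closure (R \ {z})) : y ∈ N.closure A := by
  by_cases hne : A = R
  · rwa [hne]
  obtain ⟨z₀, hz₀, hz₀A⟩ := Set.exists_of_ssubset (hA.ssubset_of_ne hne)
  have key := hR.closure_sInter_eq_biInter_closure_of_forall_subset
    (Js := (fun z => R \ {z}) '' (R \ A)) ⟨_, z₀, ⟨hz₀, hz₀A⟩, rfl⟩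
    (by rintro _ ⟨z, -, rfl⟩; exact sdiff_subset)
  have hAeq : ⋂₀ ((fun z => R \ {z}) '' (R \ A)) = A := by
    ext t
    simp only [sInter_image, mem_iInter]
    constructor
    · intro ht
      by_contra htA
      have htR := (ht z₀ ⟨hz₀, hz₀A⟩).1
      exact (ht t ⟨htR, htA⟩).2 rfl
    · intro ht z hz
      exact ⟨hA ht, fun e => hz.2 (e ▸ ht)⟩
  rw [hAeq] at key
  rw [key]
  simp only [mem_iInter]
  rintro _ ⟨z, hz, rfl⟩
  exact h z hz.1 hz.2

theorem ncard_le_of_indep_of_subset_closure [Finite β] {N : Matroid β} {I A : Set β}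
    (hI : N.Indep I) (h : I ⊆ N.closure A) : I.ncard ≤ A.ncard := by
  have h1 : I.encard ≤ A.encard :=
    (hI.encard_le_eRk_of_subset h).trans ((N.eRk_closure_eq A).le.trans (N.eRk_le_encard A))
  rw [← (toFinite I).cast_ncard_eq, ← (toFinite A).cast_ncard_eq] at h1
  exact_mod_cast h1

theorem ncard_le_ncard_diff_closure_add [Finite β] {N : Matroid β} {I : Set β}
    (hI : N.Indep I) (A : Set β) : I.ncard ≤ (I \ N.closure A).ncard + A.ncard := by
  have h1 : (I ∩ N.closure A).ncard ≤ A.ncard :=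
    ncard_le_of_indep_of_subset_closure (hI.subset inter_subset_left) inter_subset_right
  have h2 := ncard_inter_add_ncard_sdiff_eq_ncard I (N.closure A)
  omega

/-! ### Partial arrays -/

/-- The elements of `S` in the row, or column, labelled `k`. -/
def fib (g : β → γ) (S : Set β) (k : γ) : Set β := {t ∈ S | g t = k}

/-- Elements of `β` carry a row and a column label. `S` is a partial array if it has at most one
element in each cell (a row together with a column) and its rows and columns are independent. -/
structure IsPartial (N : Matroid β) (row : β → ι) (col : β → κ) (S : Set β) : Prop where
  inj : ∀ s ∈ S, ∀ t ∈ S, row s = row t → col s = col t → s = t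
  row_indep : ∀ i, N.Indep (fib row S i)
  col_indep : ∀ j, N.Indep (fib col S j)

/-- A partial array with the largest possible number of elements. -/
structure IsMaximum (N : Matroid β) (row : β → ι) (col : β → κ) (S : Set β) : Prop
    extends IsPartial N row col S where
  ncard_le : ∀ S', IsPartial N row col S' → S'.ncard ≤ S.ncard

/-- The cell `(i, c)` holds no element of `S`. -/
def IsVacant (row : β → ι) (col : β → κ) (S : Set β) (i : ι) (c : κ) : Prop :=
  ∀ t ∈ S, row t = i → col t ≠ c

/-- The data of an exchange at the vacant cell `(i, c)` of `S`: fill it with `y`, replace the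
element `z` of the cell `(i, c')` by `x`, and vacate the cell `(i', c')` by removing `w`. -/
structure Exchange (N : Matroid β) (row : β → ι) (col : β → κ) (S : Set β)
    (i : ι) (c : κ) (i' : ι) (c' : κ) (y z x w : β) : Prop where
  y_row : row y = i
  y_col : col y = c
  z_mem : z ∈ S
  z_row : row z = i
  z_col : col z = c'
  x_row : row x = i
  x_col : col x = c'
  w_mem : w ∈ S
  w_row : row w = i'
  w_col : col w = c'
  ne : i' ≠ i
  y_notMem_col : y ∉ N.closure (fib col S c)
  y_mem_row : y ∈ N.closure (fib row S i)
  y_notMem_row : y ∉ N.closure (fib row S i \ {z})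
  x_notMem_row : x ∉ N.closure (fib row S i)
  x_notMem_col : x ∉ N.closure (fib col S c' \ {z, w})

/-- Some exchange at `(i, c)` vacates `(i', c')`. -/
def CanVacate (N : Matroid β) (row : β → ι) (col : β → κ) (S : Set β)
    (i : ι) (c : κ) (i' : ι) (c' : κ) : Prop :=
  ∃ y z x w, Exchange N row col S i c i' c' y z x w

variable {N : Matroid β} {row : β → ι} {col : β → κ} {S : Set β} {i i' : ι} {c c' : κ}
  {x y z w : β}

theorem indep_insert_of_notMem_closure (hE : N.E = univ) {I : Set β} (hI : N.Indep I)
    (hx : x ∉ N.closure I) : N.Indep (insert x I) :=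
  ((hI.notMem_closure_iff (hE ▸ mem_univ x)).1 hx).1

theorem IsPartial.fill (hE : N.E = univ) (hS : IsPartial N row col S)
    (hv : IsVacant row col S i c) (hyr : row y = i) (hyc : col y = c)
    (h1 : y ∉ N.closure (fib row S i)) (h2 : y ∉ N.closure (fib col S c)) :
    IsPartial N row col (insert y S) where
  inj := by
    have := hS.inj
    unfold IsVacant at hv
    grind
  row_indep k := by
    by_cases hk : k = i
    · refine (indep_insert_of_notMem_closure hE (hS.row_indep i) h1).subset ?_
      intro t; unfold fib; grind
    · refine (hS.row_indep k).subset ?_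
      intro t; unfold fib; grind
  col_indep k := by
    by_cases hk : k = c
    · refine (indep_insert_of_notMem_closure hE (hS.col_indep c) h2).subset ?_
      intro t; unfold fib; grind
    · refine (hS.col_indep k).subset ?_
      intro t; unfold fib; grind

/-- Filling the vacant cell `(i, c)` with `y` and replacing the element `z` of `(i, c')` by `x`,
while a set `D ∋ z` is removed. -/
theorem IsPartial.swap (hE : N.E = univ) (hS : IsPartial N row col S)
    (hv : IsVacant row col S i c) (hyr : row y = i) (hyc : col y = c)
    (hz : z ∈ S) (hzr : row z = i) (hzc : col z = c') (hxr : row x = i) (hxc : col x = c')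
    {D : Set β} (hzD : z ∈ D)
    (hy_col : y ∉ N.closure (fib col S c)) (hy_row : y ∈ N.closure (fib row S i))
    (hy_row' : y ∉ N.closure (fib row S i \ {z})) (hx_row : x ∉ N.closure (fib row S i))
    (hx_col : x ∉ N.closure (fib col S c' \ D)) :
    IsPartial N row col (insert x (insert y (S \ D))) where
  inj := by
    have := hS.inj
    unfold IsVacant at hv
    grind
  row_indep k := by
    by_cases hk : k = i
    · have h1 := indep_insert_of_notMem_closure hE
        ((hS.row_indep i).subset sdiff_subset) hy_row'
      have h2 : x ∉ N.closure (insert y (fib row S i \ {z})) := by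
        refine fun h => hx_row (N.closure_subset_closure_of_subset_closure ?_ h)
        refine insert_subset hy_row (sdiff_subset.trans ?_)
        exact N.subset_closure _ (hE ▸ subset_univ _)
      refine (indep_insert_of_notMem_closure hE h1 h2).subset ?_
      intro t; unfold fib; grind
    · refine (hS.row_indep k).subset ?_
      intro t; unfold fib; grind
  col_indep k := by
    have hcc : c ≠ c' := fun h => hv z hz hzr (hzc.trans h.symm)
    by_cases hk : k = c
    · refine (indep_insert_of_notMem_closure hE (hS.col_indep c) hy_col).subset ?_
      intro t; unfold fib; grind
    by_cases hk' : k = c'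
    · have h1 : N.Indep (fib col S c' \ D) := (hS.col_indep c').subset sdiff_subset
      refine (indep_insert_of_notMem_closure hE h1 hx_col).subset ?_
      intro t; unfold fib; grind
    · refine (hS.col_indep k).subset ?_
      intro t; unfold fib; grind

theorem notMem_of_notMem_closure_row (hE : N.E = univ) (hxr : row x = i)
    (hx : x ∉ N.closure (fib row S i)) : x ∉ S :=
  fun h => hx (N.mem_closure_of_mem ⟨h, hxr⟩ (hE ▸ subset_univ _))

theorem Exchange.isVacant (hS : IsPartial N row col S)
    (h : Exchange N row col S i c i' c' y z x w) :
    IsVacant row col (insert x (insert y (S \ {z, w}))) i' c' := by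
  have := hS.inj
  obtain ⟨⟩ := h
  unfold IsVacant
  grind

/-- In a maximum array, what can be put into a vacant cell as far as its column is concerned is
spanned by its row. -/
theorem IsMaximum.mem_closure_row [Finite β] (hE : N.E = univ) (hS : IsMaximum N row col S)
    (hv : IsVacant row col S i c) (hyr : row y = i) (hyc : col y = c)
    (hy : y ∉ N.closure (fib col S c)) : y ∈ N.closure (fib row S i) := by
  by_contra h
  have h1 := hS.ncard_le _ (hS.toIsPartial.fill hE hv hyr hyc h hy)
  have hyS : y ∉ S := fun h => hv y h hyr hyc
  rw [ncard_insert_of_notMem hyS] at h1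
  omega

theorem ncard_swap [Finite β] (hv : IsVacant row col S i c) (hyr : row y = i) (hyc : col y = c)
    (hz : z ∈ S) (hzr : row z = i) (hzc : col z = c') (hxc : col x = c') (hxS : x ∉ S)
    (D : Set β) : (insert x (insert y (S \ D))).ncard = (S \ D).ncard + 2 := by
  have hcc : c ≠ c' := fun h => hv z hz hzr (hzc.trans h.symm)
  have hyS : y ∉ S := fun h => hv y h hyr hyc
  rw [ncard_insert_of_notMem, ncard_insert_of_notMem]
  · exact fun h => hyS h.1
  · rintro (h | h)
    · exact hcc (by rw [← hyc, ← hxc, h])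
    · exact hxS h.1

/-- In a maximum array, if `z` can be replaced by some `y` filling the vacant cell, then whatever
element of the cell of `z` extends the row is spanned by the column of `z` without `z`. -/
theorem IsMaximum.mem_closure_col [Finite β] (hE : N.E = univ) (hS : IsMaximum N row col S)
    (hv : IsVacant row col S i c) (hyr : row y = i) (hyc : col y = c)
    (hz : z ∈ S) (hzr : row z = i) (hzc : col z = c') (hxr : row x = i) (hxc : col x = c')
    (hy_col : y ∉ N.closure (fib col S c))
    (hy_row' : y ∉ N.closure (fib row S i \ {z})) (hx_row : x ∉ N.closure (fib row S i)) :
    x ∈ N.closure (fib col S c' \ {z}) := by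
  by_contra h
  have h1 := hS.ncard_le _ (hS.toIsPartial.swap hE hv hyr hyc hz hzr hzc hxr hxc
    (mem_singleton z) hy_col (hS.mem_closure_row hE hv hyr hyc hy_col) hy_row' hx_row h)
  rw [ncard_swap hv hyr hyc hz hzr hzc hxc (notMem_of_notMem_closure_row hE hxr hx_row),
    ← ncard_sdiff_singleton_add_one hz] at h1
  omega

/-- An exchange turns a maximum array into a maximum array. -/
theorem Exchange.isMaximum [Finite β] (hE : N.E = univ) (hS : IsMaximum N row col S)
    (hv : IsVacant row col S i c) (h : Exchange N row col S i c i' c' y z x w) :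
    IsMaximum N row col (insert x (insert y (S \ {z, w}))) := by
  refine ⟨hS.toIsPartial.swap hE hv h.y_row h.y_col h.z_mem h.z_row h.z_col h.x_row h.x_col
    (mem_insert z _) h.y_notMem_col h.y_mem_row h.y_notMem_row h.x_notMem_row h.x_notMem_col,
    fun S' hS' => (hS.ncard_le S' hS').trans ?_⟩
  rw [ncard_swap hv h.y_row h.y_col h.z_mem h.z_row h.z_col h.x_col
    (notMem_of_notMem_closure_row hE h.x_row h.x_notMem_row)]
  have hsub : ({z, w} : Set β) ⊆ S := insert_subset h.z_mem (singleton_subset_iff.2 h.w_mem)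
  have hne : z ≠ w := fun e => h.ne (by rw [← h.w_row, ← h.z_row, e])
  have h1 := ncard_sdiff_add_ncard_of_subset hsub
  rw [ncard_pair hne] at h1
  omega

/-! ### Counting the cells that can be vacated -/

/-- The elements that may be used in the cell `(i, c)`. -/
def cell (row : β → ι) (col : β → κ) (i : ι) (c : κ) : Set β := {t | row t = i ∧ col t = c}

theorem ncard_fib_col_le [Finite β] [Fintype ι] (hS : IsPartial N row col S) (c : κ) :
    (fib col S c).ncard ≤ Fintype.card ι := by
  rw [← Nat.card_eq_fintype_card, ← ncard_univ]
  refine ncard_le_ncard_of_injOn row (fun _ _ => mem_univ _) ?_ (toFinite _)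
  intro s hs t ht h
  exact hS.inj s hs.1 t ht.1 h (hs.2.trans ht.2.symm)

/-- The elements `z` of row `i` that some `y` fitting into column `c` can replace. -/
def replaceable (N : Matroid β) (row : β → ι) (col : β → κ) (S : Set β) (i : ι) (c : κ) : Set β :=
  {z ∈ fib row S i | ∃ y ∈ cell row col i c, y ∉ N.closure (fib col S c) ∧
    y ∉ N.closure (fib row S i \ {z})}

theorem card_le_ncard_replaceable [Finite β] [Fintype ι] [Fintype κ] (hE : N.E = univ)
    (hcell : ∀ i c, N.Indep (cell row col i c) ∧ (cell row col i c).ncard = Fintype.card κ)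
    (hS : IsMaximum N row col S) (hv : IsVacant row col S i c) :
    Fintype.card κ ≤ (replaceable N row col S i c).ncard + Fintype.card ι := by
  have h1 := ncard_le_ncard_diff_closure_add (hcell i c).1 (fib col S c)
  rw [(hcell i c).2] at h1
  have h2 := ncard_fib_col_le hS.toIsPartial c
  have h3 : (cell row col i c \ N.closure (fib col S c)).ncard ≤
      (replaceable N row col S i c).ncard := by
    refine ncard_le_of_indep_of_subset_closure (N := N)
      ((hcell i c).1.subset sdiff_subset) ?_
    rintro y ⟨hy, hyc⟩
    refine mem_closure_of_forall_mem_closure_diff (hS.row_indep i) (sep_subset _ _)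
      (hS.mem_closure_row hE hv hy.1 hy.2 hyc) ?_
    intro z hz hzW
    by_contra h
    exact hzW ⟨hz, y, hy, hyc, h⟩
  omega

open Classical in
/-- The arrays `σ c`, for `c ∈ Q`, are maximum, and `σ c` has `(i, c)` vacant but otherwise the
same row `i` as `S`, and the same columns up to the few in `T c`. Then exchanges in the `σ c`
outside these columns can vacate about `|Q| (|κ| - |ι|)` cells. -/
theorem card_mul_le_card_canVacate [Finite β] [Fintype ι] [Fintype κ] (hE : N.E = univ)
    (hcell : ∀ i c, N.Indep (cell row col i c) ∧ (cell row col i c).ncard = Fintype.card κ)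
    (hS : IsPartial N row col S) {Q : Finset κ} {σ : κ → Set β} {T : κ → Finset κ} {τ : ℕ}
    (hmax : ∀ c ∈ Q, IsMaximum N row col (σ c)) (hvac : ∀ c ∈ Q, IsVacant row col (σ c) i c)
    (hrow : ∀ c ∈ Q, fib row (σ c) i = {t ∈ fib row S i | col t ≠ c})
    (hcol : ∀ c ∈ Q, ∀ c' ∉ T c, fib col (σ c) c' = fib col S c')
    (hT : ∀ c ∈ Q, (T c).card ≤ τ) :
    Q.card * Fintype.card κ ≤
      (Finset.univ.filter fun p : ι × κ =>
        ∃ c ∈ Q, p.2 ∉ T c ∧ CanVacate N row col (σ c) i c p.1 p.2).card +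
      Q.card * (Fintype.card ι + τ) := by
  set A := Finset.univ.filter fun p : ι × κ =>
        ∃ c ∈ Q, p.2 ∉ T c ∧ CanVacate N row col (σ c) i c p.1 p.2 with hA
  let r : κ → κ → Prop := fun c c' =>
    c' ∉ T c ∧ ∃ z ∈ replaceable N row col (σ c) i c, col z = c'
  -- Each column offers as many new cells as there are `c ∈ Q` that make it replaceable.
  have claim1 : ∀ c', (Q.filter fun c => r c c').card ≤ (A.filter fun p => p.2 = c').card := by
    intro c'
    set Q' := Q.filter fun c => r c c' with hQ'
    rcases Q'.eq_empty_or_nonempty with h0 | ⟨c₀, hc₀⟩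
    · simp [h0]
    have hmem : ∀ c ∈ Q', c ∈ Q ∧ r c c' := fun c hc => Finset.mem_filter.1 hc
    obtain ⟨hc₀Q, hc₀T, z, hz, hzc⟩ := hmem c₀ hc₀
    have hz0 : z ∈ fib row S i := by
      have := hz.1
      rw [hrow c₀ hc₀Q] at this
      exact this.1
    have hzs : ∀ c ∈ Q', z ∈ replaceable N row col (σ c) i c := by
      intro c hc
      obtain ⟨hcQ, hcT, z', hz', hzc'⟩ := hmem c hc
      have h1 := hz'.1
      rw [hrow c hcQ] at h1
      have : z' = z := hS.inj z' h1.1.1 z hz0.1 (h1.1.2.trans hz0.2.symm) (hzc'.trans hzc.symm)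
      exact this ▸ hz'
    -- The elements that can take the place of `z` after some cell `(i, c)`, `c ∈ Q'`, is filled.
    set X : Set β := {x ∈ cell row col i c' | ∃ c ∈ Q', x ∉ N.closure (fib row (σ c) i)} with hX
    have hXcard : Q'.card ≤ X.ncard := by
      have h1 := ncard_le_ncard_diff_closure_add (hcell i c').1 {t ∈ fib row S i | col t ∉ Q'}
      rw [(hcell i c').2] at h1
      have h2 : ({t ∈ fib row S i | col t ∉ Q'} : Set β).ncard ≤ (Finset.univ \ Q').card := by
        rw [← ncard_coe_finset]
        refine ncard_le_ncard_of_injOn col (fun t ht => by simpa using ht.2) ?_ (toFinite _)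
        intro s hs t ht h
        exact hS.inj s hs.1.1 t ht.1.1 (hs.1.2.trans ht.1.2.symm) h
      have h3 : (cell row col i c' \ N.closure {t ∈ fib row S i | col t ∉ Q'}).ncard ≤ X.ncard := by
        refine ncard_le_ncard ?_ (toFinite _)
        rintro x ⟨hx, hxc⟩
        refine ⟨hx, ?_⟩
        by_contra! h
        refine hxc (mem_closure_of_forall_mem_closure_diff (hS.row_indep i) (sep_subset _ _) ?_ ?_)
        · refine N.closure_subset_closure ?_ (h c₀ hc₀)
          rw [hrow c₀ hc₀Q]
          exact sep_subset _ _
        · intro t ht htA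
          have htQ : col t ∈ Q' := by
            by_contra hh
            exact htA ⟨ht, hh⟩
          refine N.closure_subset_closure ?_ (h _ htQ)
          rw [hrow _ (hmem _ htQ).1]
          rintro s ⟨hs, hst⟩
          exact ⟨hs, fun e => hst (by rw [mem_singleton_iff.1 e])⟩
      have h4 := Finset.card_sdiff_add_card_eq_card (Finset.subset_univ Q')
      rw [Finset.card_univ] at h4
      omega
    -- The elements of column `c'` whose removal makes room for some `x ∈ X`.
    set E : Set β := {w ∈ fib col S c' \ {z} | ∃ x ∈ X, x ∉ N.closure ((fib col S c' \ {z}) \ {w})}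
      with hEdef
    have hXE : X.ncard ≤ E.ncard := by
      refine ncard_le_of_indep_of_subset_closure (N := N)
        ((hcell i c').1.subset (sep_subset _ _)) ?_
      intro x hx
      refine mem_closure_of_forall_mem_closure_diff ((hS.col_indep c').subset sdiff_subset)
        (sep_subset _ _) ?_ ?_
      · obtain ⟨hxc, c, hc, hxr⟩ := hx
        obtain ⟨hcQ, hcT, -⟩ := hmem c hc
        obtain ⟨hzr, y, hy, hyc, hyr⟩ := hzs c hc
        have := (hmax c hcQ).mem_closure_col hE (hvac c hcQ) hy.1 hy.2 hzr.1 hzr.2 hzc hxc.1 hxc.2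
          hyc hyr hxr
        rwa [hcol c hcQ c' hcT] at this
      · intro w hw hwE
        by_contra h
        exact hwE ⟨hw, x, hx, h⟩
    refine hXcard.trans (hXE.trans ?_)
    rw [← ncard_coe_finset]
    refine ncard_le_ncard_of_injOn (fun w => (row w, c')) ?_ ?_ (toFinite _)
    · rintro w ⟨⟨hw, hwz⟩, x, ⟨hxc, c, hc, hxr⟩, hxw⟩
      obtain ⟨hcQ, hcT, -⟩ := hmem c hc
      obtain ⟨hzr, y, hy, hyc, hyr⟩ := hzs c hc
      simp only [Finset.coe_filter, hA, Finset.mem_filter, Finset.mem_univ, true_and,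
        mem_ofPred_eq, and_true]
      refine ⟨c, hcQ, hcT, y, z, x, w, ?_⟩
      have hw' : w ∈ fib col (σ c) c' := by rwa [hcol c hcQ c' hcT]
      refine ⟨hy.1, hy.2, hzr.1, hzr.2, hzc, hxc.1, hxc.2, hw'.1, rfl, hw.2, ?_, hyc,
        (hmax c hcQ).mem_closure_row hE (hvac c hcQ) hy.1 hy.2 hyc, hyr, hxr, ?_⟩
      · exact fun e => hwz (hS.inj w hw.1 z hz0.1 (e.trans hz0.2.symm) (hw.2.trans hzc.symm))
      · rwa [hcol c hcQ c' hcT, insert_eq, ← Set.sdiff_sdiff]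
    · intro s hs t ht h
      exact hS.inj s hs.1.1.1 t ht.1.1.1 (Prod.ext_iff.1 h).1 (hs.1.1.2.trans ht.1.1.2.symm)
  have claim2 : ∀ c ∈ Q, Fintype.card κ ≤
      (Finset.univ.filter fun c' => r c c').card + (Fintype.card ι + τ) := by
    intro c hc
    have h1 := card_le_ncard_replaceable hE hcell (hmax c hc) (hvac c hc)
    have h2 : (replaceable N row col (σ c) i c).ncard ≤
        ((Finset.univ.filter fun c' => r c c') ∪ T c).card := by
      rw [← ncard_coe_finset]
      refine ncard_le_ncard_of_injOn col ?_ ?_ (toFinite _)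
      · intro z hz
        by_cases h : col z ∈ T c
        · simp [h]
        · simp only [Finset.coe_union, Finset.coe_filter, Finset.mem_univ, true_and]
          exact Or.inl ⟨h, z, hz, rfl⟩
      · intro s hs t ht h
        exact (hmax c hc).inj s hs.1.1 t ht.1.1 (hs.1.2.trans ht.1.2.symm) h
    have h3 := Finset.card_union_le (Finset.univ.filter fun c' => r c c') (T c)
    have h4 := hT c hc
    omega
  have hsumA : A.card = ∑ c', (A.filter fun p => p.2 = c').card :=
    Finset.card_eq_sum_card_fiberwise fun _ _ => Finset.mem_coe.2 (Finset.mem_univ _)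
  have hdc : ∑ c ∈ Q, (Finset.univ.filter fun c' => r c c').card =
      ∑ c', (Q.filter fun c => r c c').card := by
    simpa [Finset.bipartiteAbove, Finset.bipartiteBelow] using
      Finset.sum_card_bipartiteAbove_eq_sum_card_bipartiteBelow (s := Q) (t := Finset.univ) r
  calc Q.card * Fintype.card κ = ∑ c ∈ Q, Fintype.card κ := by simp
    _ ≤ ∑ c ∈ Q, ((Finset.univ.filter fun c' => r c c').card + (Fintype.card ι + τ)) :=
        Finset.sum_le_sum claim2
    _ = ∑ c', (Q.filter fun c => r c c').card + Q.card * (Fintype.card ι + τ) := by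
        rw [Finset.sum_add_distrib, hdc]; simp
    _ ≤ A.card + Q.card * (Fintype.card ι + τ) := by
        rw [hsumA]
        gcongr with c'
        exact claim1 c'

/-! ### Cascades of exchanges -/

/-- `σ` is a maximum array in which the cell `(i, c)` is vacant. Outside the rows of `P` it agrees
with `S` but for this cell, and outside the at most `2 * l` columns of `T` it agrees with `S`. Such
a `σ` arises from `S` by `l` exchanges at cells in the rows of `P`, the last of which vacates
`(i, c)`. -/
structure IsCascade (N : Matroid β) (row : β → ι) (col : β → κ) (S : Set β) (P : Finset ι) (l : ℕ)
    (i : ι) (c : κ) (σ : Set β) (T : Finset κ) : Prop where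
  isMaximum : IsMaximum N row col σ
  isVacant : IsVacant row col σ i c
  row_notMem : i ∉ P
  card_le : T.card ≤ 2 * l
  col_eq : ∀ t, col t ∉ T → (t ∈ σ ↔ t ∈ S)
  row_eq : ∀ t, row t ∉ P → (t ∈ σ ↔ t ∈ S ∧ ¬(row t = i ∧ col t = c))

/-- The cell `(i, c)` can be vacated by a cascade from `S` of length `l` through the rows `P`. -/
def IsReachable (N : Matroid β) (row : β → ι) (col : β → κ) (S : Set β) (P : Finset ι) (l : ℕ)
    (i : ι) (c : κ) : Prop :=
  ∃ σ T, IsCascade N row col S P l i c σ T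

theorem isReachable_zero (hS : IsMaximum N row col S) (hv : IsVacant row col S i c) :
    IsReachable N row col S ∅ 0 i c := by
  refine ⟨S, ∅, hS, hv, by simp, by simp, by simp, fun t _ => ⟨fun h => ⟨h, ?_⟩, fun h => h.1⟩⟩
  exact fun h' => hv t h h'.1 h'.2

open Classical in
theorem IsCascade.isReachable_insert [Finite β] (hE : N.E = univ) (hS : IsMaximum N row col S) {P : Finset ι}
    {l : ℕ} {σ : Set β} {T : Finset κ} (h : IsCascade N row col S P l i c σ T)
    (hstep : CanVacate N row col σ i c i' c') (hi' : i' ∉ P) :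
    IsReachable N row col S (insert i P) (l + 1) i' c' := by
  obtain ⟨y, z, x, w, hx⟩ := hstep
  refine ⟨_, insert c (insert c' T), hx.isMaximum hE h.isMaximum h.isVacant,
    hx.isVacant h.isMaximum.toIsPartial, ?_, ?_, ?_, ?_⟩
  · simp [hi', hx.ne]
  · have h1 := Finset.card_insert_le c (insert c' T)
    have h2 := Finset.card_insert_le c' T
    have h3 := h.card_le
    omega
  · intro t ht
    have h1 := h.col_eq t
    obtain ⟨⟩ := hx
    simp only [Finset.mem_insert, not_or] at ht
    have := h1 ht.2.2
    grind
  · intro t ht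
    have h1 := h.row_eq t
    have h2 := h.row_eq w (hx.w_row ▸ hi')
    have h3 := hS.inj
    obtain ⟨⟩ := hx
    simp only [Finset.mem_insert, not_or] at ht
    have := h1 ht.2
    grind

/-- In every maximum array, the exchanges at one vacant cell can vacate at most `Λ` cells of
each row. -/
def IsSpread [Fintype κ] (N : Matroid β) (row : β → ι) (col : β → κ) (Λ : ℕ) : Prop :=
  ∀ S i c, IsMaximum N row col S → IsVacant row col S i c → ∀ i',
    {c' | CanVacate N row col S i c i' c'}.ncard ≤ Λ

open Classical in
/-- If the cells `(i, c)`, `c ∈ Q`, can be reached by cascades of length `l`, then in some row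
at least `|Q| (|κ| - |ι| - 2 l - l Λ) / |ι|` cells can be reached by longer cascades. -/
theorem exists_isReachable_of_isReachable [Finite β] [Fintype ι] [Fintype κ] (hE : N.E = univ)
    (hcell : ∀ i c, N.Indep (cell row col i c) ∧ (cell row col i c).ncard = Fintype.card κ)
    (hS : IsMaximum N row col S) {P : Finset ι} {l Λ : ℕ} (hPl : P.card ≤ l) {Q : Finset κ}
    (hQ : ∀ c ∈ Q, IsReachable N row col S P l i c)
    (hΛ : IsSpread N row col Λ ∨ Fintype.card κ ≤ Q.card * Λ) :
    ∃ (i' : ι) (Q' : Finset κ), (∀ c ∈ Q', IsReachable N row col S (insert i P) (l + 1) i' c) ∧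
      Q.card * Fintype.card κ ≤
        Fintype.card ι * Q'.card + Q.card * (Fintype.card ι + 2 * l + l * Λ) := by
  choose! σ T hσ using hQ
  have hcount := card_mul_le_card_canVacate (i := i) (Q := Q) (σ := σ) (T := T) (τ := 2 * l) hE
    hcell hS.toIsPartial
    (fun c hc => (hσ c hc).isMaximum) (fun c hc => (hσ c hc).isVacant) ?_ ?_
    (fun c hc => (hσ c hc).card_le)
  rotate_left
  · intro c hc
    ext t
    have h1 := (hσ c hc).row_eq t
    have h2 := (hσ c hc).row_notMem
    simp only [fib, mem_sep_iff]
    grind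
  · intro c hc c' hc'
    ext t
    have h1 := (hσ c hc).col_eq t
    simp only [fib, mem_sep_iff]
    grind
  set A := Finset.univ.filter fun p : ι × κ =>
        ∃ c ∈ Q, p.2 ∉ T c ∧ CanVacate N row col (σ c) i c p.1 p.2 with hA
  let Ar : ι → Finset κ := fun i' => Finset.univ.filter fun c' => (i', c') ∈ A
  have hAr : ∀ i', (A.filter fun p => p.1 = i').card = (Ar i').card := by
    intro i'
    symm
    refine Finset.card_bij (fun c' _ => (i', c')) ?_ ?_ ?_
    · intro c' hc'
      simpa [Ar] using hc'
    · intro a _ b _ h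
      exact (Prod.ext_iff.1 h).2
    · rintro ⟨a, b⟩ h
      obtain ⟨h, rfl⟩ := Finset.mem_filter.1 h
      exact ⟨b, by simpa [Ar] using h, rfl⟩
  have hsumA : A.card = ∑ i', (Ar i').card := by
    rw [← Finset.sum_congr rfl fun i' _ => hAr i']
    exact Finset.card_eq_sum_card_fiberwise fun _ _ => Finset.mem_coe.2 (Finset.mem_univ _)
  have hlost : ∀ i' ∈ P, (Ar i').card ≤ Q.card * Λ := by
    intro i' _
    rcases hΛ with hΛ | hΛ
    · have hsub : Ar i' ⊆ Q.biUnion fun c =>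
          Finset.univ.filter fun c' => CanVacate N row col (σ c) i c i' c' := by
        intro c' hc'
        obtain ⟨c, hc, -, h⟩ : ∃ c ∈ Q, c' ∉ T c ∧ CanVacate N row col (σ c) i c i' c' := by
          simpa [Ar, hA] using hc'
        simpa using ⟨c, hc, h⟩
      refine (Finset.card_le_card hsub).trans (Finset.card_biUnion_le_card_mul _ _ _ ?_)
      intro c hc
      have := hΛ (σ c) i c (hσ c hc).isMaximum (hσ c hc).isVacant i'
      rw [← ncard_coe_finset]
      simpa using this
    · exact (Finset.card_le_univ _).trans hΛ
  have hlostsum : ∑ i' ∈ P, (Ar i').card ≤ l * (Q.card * Λ) :=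
    (Finset.sum_le_card_nsmul _ _ _ hlost).trans (by rw [smul_eq_mul]; gcongr)
  obtain ⟨i₁, -, hi₁⟩ := Finset.exists_max_image Finset.univ
    (fun i' => if i' ∈ P then 0 else (Ar i').card) ⟨i, Finset.mem_univ i⟩
  refine ⟨i₁, if i₁ ∈ P then ∅ else Ar i₁, ?_, ?_⟩
  · intro c' hc'
    by_cases h : i₁ ∈ P
    · simp [h] at hc'
    · rw [if_neg h] at hc'
      obtain ⟨c, hc, -, hstep⟩ : ∃ c ∈ Q, c' ∉ T c ∧ CanVacate N row col (σ c) i c i₁ c' := by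
        simpa [Ar, hA] using hc'
      exact (hσ c hc).isReachable_insert hE hS hstep h
  · have hgood : ∑ i', (if i' ∈ P then 0 else (Ar i').card) ≤
        Fintype.card ι * (if i₁ ∈ P then ∅ else Ar i₁).card := by
      refine (Finset.sum_le_card_nsmul _ _ _ hi₁).trans ?_
      rw [smul_eq_mul, Finset.card_univ]
      split_ifs <;> simp
    have hsplit : ∑ i', (Ar i').card =
        ∑ i', (if i' ∈ P then 0 else (Ar i').card) + ∑ i' ∈ P, (Ar i').card := by
      rw [← Finset.sum_filter_add_sum_filter_not Finset.univ (fun i' => i' ∉ P), Finset.sum_ite]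
      simp
    rw [hsumA, hsplit] at hcount
    linarith

/-- A maximum array has no vacant cell, provided that `|κ| - |ι| - 2 l - l Λ` exceeds `|ι|` by a
factor `r` for every `l ≤ L`, where `L` is so large that `r ^ L` exceeds `|κ|`. -/
theorem IsMaximum.not_isVacant [Finite β] [Fintype ι] [Fintype κ] (hE : N.E = univ)
    (hcell : ∀ i c, N.Indep (cell row col i c) ∧ (cell row col i c).ncard = Fintype.card κ)
    {L Λ : ℕ} {r : ℝ} (hr : 1 ≤ r) (hΛ : Fintype.card κ ≤ Λ * Λ)
    (hL : (Fintype.card κ : ℝ) < r ^ L)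
    (hgrow : r * Fintype.card ι + (Fintype.card ι + 2 * L + L * Λ) ≤ Fintype.card κ)
    (hS : IsMaximum N row col S) : ¬ IsVacant row col S i c := by
  intro hv
  -- A start from which the lost cells can be controlled at every later stage.
  obtain ⟨S₀, hS₀, P₀, l₀, hl₀, i₀, Q₀, hP₀, hQ₀, hne, hΛ₀⟩ : ∃ S₀, IsMaximum N row col S₀ ∧
      ∃ (P : Finset ι) (l : ℕ), l ≤ 1 ∧ ∃ (i : ι) (Q : Finset κ), P.card ≤ l ∧
      (∀ c ∈ Q, IsReachable N row col S₀ P l i c) ∧ 1 ≤ Q.card ∧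
      (IsSpread N row col Λ ∨ Fintype.card κ ≤ Q.card * Λ) := by
    classical
    by_cases hsp : IsSpread N row col Λ
    · refine ⟨S, hS, ∅, 0, by simp, i, {c}, by simp, ?_, by simp, Or.inl hsp⟩
      intro c₁ hc₁
      rw [Finset.mem_singleton.1 hc₁]
      exact isReachable_zero hS hv
    · unfold IsSpread at hsp
      push Not at hsp
      obtain ⟨S₀, i, c, hS₀, hv₀, i', hlt⟩ := hsp
      set Q : Finset κ := Finset.univ.filter fun c' => CanVacate N row col S₀ i c i' c' with hQ
      have hQΛ : Λ < Q.card := by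
        rw [← ncard_coe_finset]
        simpa [hQ] using hlt
      refine ⟨S₀, hS₀, {i}, 1, le_rfl, i', Q, by simp, ?_, by omega, Or.inr ?_⟩
      · intro c' hc'
        have hstep : CanVacate N row col S₀ i c i' c' := by simpa [hQ] using hc'
        obtain ⟨σ, T, h⟩ := isReachable_zero hS₀ hv₀
        have hσ : σ = S₀ := by
          ext t
          have h1 := h.row_eq t (by simp)
          have h2 : t ∈ S₀ → ¬(row t = i ∧ col t = c) := fun ht h' => hv₀ t ht h'.1 h'.2
          tauto
        rw [hσ] at h
        simpa using h.isReachable_insert hE hS₀ hstep (by simp)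
      · exact hΛ.trans (Nat.mul_le_mul_right _ hQΛ.le)
  have hι : (0 : ℝ) < Fintype.card ι := by
    have : 0 < Fintype.card ι := Fintype.card_pos_iff.2 ⟨i⟩
    exact_mod_cast this
  have hiter : ∀ k, k ≤ L → ∃ (P : Finset ι) (l : ℕ), l ≤ k + 1 ∧ ∃ (i : ι) (Q : Finset κ),
      P.card ≤ l ∧ (∀ c ∈ Q, IsReachable N row col S₀ P l i c) ∧ r ^ k ≤ Q.card ∧
      (IsSpread N row col Λ ∨ Fintype.card κ ≤ Q.card * Λ) := by
    intro k
    induction k with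
    | zero =>
      intro _
      exact ⟨P₀, l₀, by omega, i₀, Q₀, hP₀, hQ₀, by simpa using hne, hΛ₀⟩
    | succ k ih =>
      intro hk
      obtain ⟨P, l, hl, i, Q, hP, hQ, hrQ, hloss⟩ := ih (by omega)
      obtain ⟨i', Q', hQ', hcard⟩ := exists_isReachable_of_isReachable hE hcell hS₀ hP hQ hloss
      have hgrow' : r * (Q.card : ℝ) ≤ Q'.card := by
        have h1 : ((Q.card : ℝ)) * Fintype.card κ ≤
            Fintype.card ι * Q'.card + Q.card * (Fintype.card ι + 2 * l + l * Λ) := by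
          exact_mod_cast hcard
        have hlL : (l : ℝ) ≤ L := by
          have : l ≤ L := by omega
          exact_mod_cast this
        have h2 : r * Fintype.card ι + (Fintype.card ι + 2 * l + l * (Λ : ℝ)) ≤
            Fintype.card κ := by
          refine le_trans ?_ hgrow
          gcongr
        have h3 := mul_le_mul_of_nonneg_left h2 (Nat.cast_nonneg (α := ℝ) Q.card)
        refine le_of_mul_le_mul_left ?_ hι
        linarith
      have hmono : Q.card ≤ Q'.card := by
        have : (Q.card : ℝ) ≤ Q'.card :=
          (le_mul_of_one_le_left (Nat.cast_nonneg _) hr).trans hgrow'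
        exact_mod_cast this
      classical
      refine ⟨insert i P, l + 1, by omega, i', Q', ?_, ?_, ?_, ?_⟩
      · exact (Finset.card_insert_le _ _).trans (by omega)
      · convert hQ'
      · rw [pow_succ']
        exact (mul_le_mul_of_nonneg_left hrQ (by linarith)).trans hgrow'
      · exact hloss.imp_right fun h => h.trans (Nat.mul_le_mul_right _ hmono)
  obtain ⟨P, l, -, i, Q, -, -, hQ, -⟩ := hiter L le_rfl
  have h1 : (Q.card : ℝ) ≤ Fintype.card κ := by exact_mod_cast Finset.card_le_univ Q
  linarith

theorem exists_isMaximum [Finite β] (N : Matroid β) (row : β → ι) (col : β → κ) :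
    ∃ S, IsMaximum N row col S := by
  have hrow (i) : fib row (∅ : Set β) i = ∅ := by simp [fib]
  have hcol (c) : fib col (∅ : Set β) c = ∅ := by simp [fib]
  have h0 : IsPartial N row col ∅ :=
    ⟨by simp, fun i => (hrow i).symm ▸ N.empty_indep, fun c => (hcol c).symm ▸ N.empty_indep⟩
  obtain ⟨S, hS, hmax⟩ :=
    Set.exists_max_image {S | IsPartial N row col S} Set.ncard (toFinite _) ⟨∅, h0⟩
  exact ⟨S, hS, hmax⟩

/-! ### Choice of the parameters and completion of the array -/

open Filter in
theorem exists_cascade_parameters (ε : ℝ) (hε : 0 < ε) : ∃ N : ℕ, ∀ n : ℕ, N ≤ n →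
    ∃ L Λ : ℕ, n ≤ Λ * Λ ∧ (n : ℝ) < (1 + ε) ^ L ∧ (2 * L + L * Λ : ℝ) ≤ ε * n / 2 := by
  have hlim := tendsto_pow_const_div_const_pow_of_one_lt 4 (r := 1 + ε) (by linarith)
  obtain ⟨M, hM⟩ := eventually_atTop.1 (hlim.eventually (gt_mem_nhds one_pos))
  obtain ⟨K, hK⟩ := exists_nat_gt (24 / ε)
  set m₀ := max (max M K) 1 with hm₀
  refine ⟨m₀ * m₀ * (m₀ * m₀), fun n hn => ?_⟩
  set s := Nat.sqrt n with hs
  set m := Nat.sqrt s with hm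
  have hms : m₀ ≤ m := Nat.le_sqrt.2 (Nat.le_sqrt.2 hn)
  have hMm : M ≤ m := ((le_max_left _ _).trans (le_max_left _ _)).trans hms
  have hKm : K ≤ m := ((le_max_right _ _).trans (le_max_left _ _)).trans hms
  have h1m : 1 ≤ m := (le_max_right _ _).trans hms
  have h1 : n < (s + 1) * (s + 1) := Nat.lt_succ_sqrt n
  have h2 : s + 1 ≤ (m + 1) * (m + 1) := Nat.lt_succ_sqrt s
  have h3 : m * m ≤ s := Nat.sqrt_le s
  have h4 : s * s ≤ n := Nat.sqrt_le n
  refine ⟨m + 1, s + 1, h1.le, ?_, ?_⟩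
  · have h5 := hM (m + 1) (by omega)
    rw [div_lt_one (by positivity)] at h5
    refine lt_of_le_of_lt ?_ h5
    have h6 : n ≤ (m + 1) ^ 4 := by
      calc n ≤ (s + 1) * (s + 1) := h1.le
        _ ≤ ((m + 1) * (m + 1)) * ((m + 1) * (m + 1)) := Nat.mul_le_mul h2 h2
        _ = (m + 1) ^ 4 := by ring
    exact_mod_cast h6
  · have hm1 : (1 : ℝ) ≤ m := by exact_mod_cast h1m
    have h5 : ((s + 1 : ℕ) : ℝ) ≤ (m + 1) * (m + 1) := by exact_mod_cast h2
    have h6 : (m : ℝ) ^ 4 ≤ n := by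
      have : m ^ 4 ≤ n := by
        calc m ^ 4 = (m * m) * (m * m) := by ring
          _ ≤ s * s := Nat.mul_le_mul h3 h3
          _ ≤ n := h4
      exact_mod_cast this
    have h7 : 24 ≤ ε * m := by
      have : (K : ℝ) ≤ m := by exact_mod_cast hKm
      have := (div_lt_iff₀ hε).1 (hK.trans_le this)
      linarith
    have h8 : ((m : ℝ) + 1) * (m + 1) ≤ 4 * m ^ 2 := by nlinarith
    calc (2 * (m + 1 : ℕ) + (m + 1 : ℕ) * (s + 1 : ℕ) : ℝ)
        = (m + 1) * (2 + (s + 1 : ℕ)) := by push_cast; ring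
      _ ≤ (2 * m) * (2 * m ^ 2 + 4 * m ^ 2) := by
          gcongr
          · linarith
          · nlinarith
          · exact h5.trans h8
      _ = 24 * (m : ℝ) ^ 3 / 2 := by ring
      _ ≤ (ε * m) * (m : ℝ) ^ 3 / 2 := by gcongr
      _ = ε * (m : ℝ) ^ 4 / 2 := by ring
      _ ≤ ε * n / 2 := by gcongr

/-- Under the numerical conditions that make cascades grow, all `f` rows can be completed. -/
theorem exists_transversals {α : Type*} {M : Matroid α} {f n L Λ : ℕ} {r : ℝ}
    (hM : M.eRank = n) {B : Fin f → Fin n → Set α} (hB : ∀ i j, M.IsBase (B i j))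
    (hr : 1 ≤ r) (hΛ : n ≤ Λ * Λ) (hL : (n : ℝ) < r ^ L)
    (hgrow : r * f + (f + 2 * L + L * Λ) ≤ n) :
    ∃ b : Fin f → Fin n → α, (∀ i j, b i j ∈ B i j) ∧
      (∀ j, Function.Injective (fun i => b i j) ∧ M.Indep (range fun i => b i j)) ∧
      ∀ i, M.IsBase (range (b i)) := by
  have henc : ∀ i j, (B i j).encard = n := fun i j => by rw [(hB i j).encard_eq_eRank, hM]
  have hfin : ∀ i j, (B i j).Finite := fun i j => finite_of_encard_eq_coe (henc i j)
  -- Elements are tagged with their cell, so that copies in different cells become parallel.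
  let β := {p : α × Fin f × Fin n // p.1 ∈ B p.2.1 p.2.2}
  let row : β → Fin f := fun p => p.1.2.1
  let col : β → Fin n := fun p => p.1.2.2
  let π : β → α := fun p => p.1.1
  let N : Matroid β := M.comap π
  have : Finite β := by
    refine Set.Finite.to_subtype (s := {p : α × Fin f × Fin n | p.1 ∈ B p.2.1 p.2.2})
      (((finite_iUnion fun i => finite_iUnion (hfin i)).prod finite_univ).subset ?_)
    rintro ⟨a, i, j⟩ h
    exact ⟨mem_iUnion₂.2 ⟨i, j, h⟩, mem_univ _⟩
  have hE : N.E = univ := eq_univ_of_forall fun p => (hB _ _).subset_ground p.2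
  have hπcell : ∀ i j, InjOn π (cell row col i j) ∧ π '' cell row col i j = B i j := by
    intro i j
    constructor
    · rintro ⟨⟨a, i₁, j₁⟩, h⟩ ⟨h1, h2⟩ ⟨⟨a', i₂, j₂⟩, h'⟩ ⟨h3, h4⟩ e
      simp only [row, col, π] at h1 h2 h3 h4 e
      subst h1 h2 h3 h4 e
      rfl
    · ext a
      constructor
      · rintro ⟨⟨⟨a', i₁, j₁⟩, h⟩, ⟨h1, h2⟩, e⟩
        simp only [row, col, π] at h1 h2 e
        subst h1 h2 e
        exact h
      · exact fun h => ⟨⟨(a, i, j), h⟩, ⟨rfl, rfl⟩, rfl⟩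
  have hcell : ∀ i c, N.Indep (cell row col i c) ∧
      (cell row col i c).ncard = Fintype.card (Fin n) := by
    intro i j
    obtain ⟨h1, h2⟩ := hπcell i j
    refine ⟨Matroid.comap_indep_iff.2 ⟨h2 ▸ (hB i j).indep, h1⟩, ?_⟩
    rw [← h1.ncard_image, h2, Fintype.card_fin, ncard_def, henc]
    rfl
  obtain ⟨S, hS⟩ := exists_isMaximum N row col
  have hfull : ∀ i j, ∃ t ∈ S, row t = i ∧ col t = j := by
    intro i j
    have := hS.not_isVacant (i := i) (c := j) hE hcell hr (by simpa using hΛ)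
      (by simpa using hL) (by simpa using hgrow)
    unfold IsVacant at this
    push Not at this
    exact this
  choose t htS htr htc using hfull
  refine ⟨fun i j => π (t i j), fun i j => ?_, fun j => ?_, fun i => ?_⟩
  · have := (t i j).2
    have h1 : (t i j).1.2.1 = i := htr i j
    have h2 : (t i j).1.2.2 = j := htc i j
    rwa [h1, h2] at this
  · obtain ⟨h1, h2⟩ := Matroid.comap_indep_iff.1 (hS.col_indep j)
    constructor
    · intro i i' h
      have := h2 ⟨htS i j, htc i j⟩ ⟨htS i' j, htc i' j⟩ h
      rw [← htr i j, ← htr i' j, this]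
    · refine h1.subset ?_
      rintro _ ⟨i, rfl⟩
      exact ⟨t i j, ⟨htS i j, htc i j⟩, rfl⟩
  · obtain ⟨h1, h2⟩ := Matroid.comap_indep_iff.1 (hS.row_indep i)
    have hinj : Function.Injective fun j => π (t i j) := by
      intro j j' h
      have := h2 ⟨htS i j, htr i j⟩ ⟨htS i j', htr i j'⟩ h
      rw [← htc i j, ← htc i j', this]
    have hind : M.Indep (range fun j => π (t i j)) := by
      refine h1.subset ?_
      rintro _ ⟨j, rfl⟩
      exact ⟨t i j, ⟨htS i j, htr i j⟩, rfl⟩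
    have hcard : (range fun j => π (t i j)).encard = M.eRank := by
      rw [← image_univ, hinj.encard_image, hM]
      simp
    refine hind.isBase_of_eRk_ge (toFinite _) ?_
    rw [hind.eRk_eq_encard, hcard]

end PartialArray

open PartialArray in
theorem theorem1p2 (ε : ℝ) (hε : 0 < ε) :
    ∃ N : ℕ, ∀ n : ℕ, N ≤ n → ∀ (f : ℕ), f = ⌊(1 - ε) * (n : ℝ) / 2⌋₊ →
      ∀ {α : Type*} (M : Matroid α), M.eRank = (n : ℕ∞) →
      ∀ B : Fin f → Fin n → Set α, (∀ i j, M.IsBase (B i j)) →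
        ∃ (b : Fin f → Fin n → α) (L : Finset (Fin f)),
          (∀ i j, b i j ∈ B i j) ∧
          (∀ j, Set.InjOn (fun i => b i j) (L : Set (Fin f)) ∧
            M.Indep ((fun i => b i j) '' (L : Set (Fin f)))) ∧
          (∀ i ∈ L, M.IsBase (Set.range (b i))) ∧
          (1 / 2 - ε) * (n : ℝ) ≤ (L.card : ℝ) := by
  obtain ⟨N₁, hN₁⟩ := exists_cascade_parameters ε hε
  obtain ⟨N₂, hN₂⟩ := exists_nat_gt (2 / ε)
  refine ⟨max N₁ N₂, fun n hn f hf α M hM B hB => ?_⟩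
  have hn2 : 2 ≤ ε * n := by
    have : (N₂ : ℝ) ≤ n := by exact_mod_cast (le_max_right _ _).trans hn
    have := (div_lt_iff₀ hε).1 (hN₂.trans_le this)
    linarith
  have hcard : (1 / 2 - ε) * (n : ℝ) ≤ f := by
    have := Nat.lt_floor_add_one ((1 - ε) * (n : ℝ) / 2)
    rw [← hf] at this
    linarith
  rcases Nat.eq_zero_or_pos f with h0 | hpos
  · subst h0
    exact ⟨fun i => i.elim0, ∅, fun i => i.elim0, by simp, by simp, by simpa using hcard⟩
  obtain ⟨L, Λ, hΛ, hL, hloss⟩ := hN₁ n ((le_max_left _ _).trans hn)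
  have hgrow : (1 + ε) * f + (f + 2 * L + L * Λ) ≤ n := by
    have hf1 : (1 : ℝ) ≤ f := by exact_mod_cast hpos
    have hfle : (f : ℝ) ≤ (1 - ε) * n / 2 := by
      have hx := Nat.pos_of_floor_pos (hf ▸ hpos)
      exact hf ▸ Nat.floor_le hx.le
    nlinarith
  obtain ⟨b, hb, hcol, hrow⟩ := exists_transversals hM hB (by linarith) hΛ hL hgrow
  exact ⟨b, Finset.univ, hb, fun j => ⟨(hcol j).1.injOn, by simpa using (hcol j).2⟩,
    fun i _ => hrow i, by simpa using hcard⟩
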